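/- Fix an integer cutoff $\Lambda\ge 1$ and let $a$ be the truncated annihilation operator on $\mathcal H_\Lambda=\mathrm{span}\{|0\rangle,\dots,|\Lambda\rangle\}$, $a|n\rangle=\sqrt n\,|n-1\rangle$, $a|0\rangle=0$, with adjoint $a^\dagger$. On $\mathbb C^2\otimes\mathcal H_\Lambda$ (a qubit and a mode), written in $2\times2$ blocks according to the qubit basis, let $$\mathcal S_1(\tau)=\exp\left(i\tau\begin{bmatrix}0&a^\dagger\\ a&0\end{bmatrix}\right),\qquad \tau>0 .$$ A circuit is a finite product of operators $\mathcal S_1(\tau)$ with arbitrary $\tau>0$ and of the single-qubit gates $X$ (Pauli), $\mathrm{Had}$ (Hadamard), $S=\mathrm{diag}(1,i)$ and $S^\dagger$; only the $\mathcal S_1$ operations are counted. For $\omega,\kappa\in\mathbb R$ put $$H=\omega a^\dagger a+\frac{\kappa}{2}(a^\dagger)^2a^2,\qquad K=-\Big(\omega\, a a^\dagger+\frac{\kappa}{2}a^2(a^\dagger)^2\Big).$$ There are absolute constants $C,c>0$ such that for every integer $q\ge1$, every integer $\Lambda\ge1$, all $\omega,\kappa\in\mathbb R$, every evolution time $t\ge0$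 and every error tolerance $\epsilon>0$, the following holds: for every integer $r\ge 0$ with $$ r\ \ge\ C\,\frac{\big(\Lambda^4\max(|\omega|,|\kappa|)\,t\big)^{1+1/(q-\frac34)}}{\epsilon^{1/(q-\frac34)}}$$ there is a circuit $U$ with at most $r\,e^{cq}$ operations $\mathcal S_1$ such that, in the operator norm, $$\left\|\,U-\exp\left(it\begin{bmatrix}H&0\\0&K\end{bmatrix}\right)\right\|\le\epsilon .$$ -/

import Mathlib

noncomputable section

namespace HybridOscillator

/-- The annihilation operator of a bosonic mode truncated to at most `Λ` photons, in the Fock basis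
`|0⟩, …, |Λ⟩`: `a |n⟩ = √n |n - 1⟩`. The creation operator is its conjugate transpose. -/
def annih (Λ : ℕ) : Matrix (Fin (Λ + 1)) (Fin (Λ + 1)) ℂ :=
  Matrix.of fun m n => if (m : ℕ) + 1 = (n : ℕ) then ((Real.sqrt (n : ℝ) : ℝ) : ℂ) else 0

/-- The creation operator of the truncated mode. -/
def creat (Λ : ℕ) : Matrix (Fin (Λ + 1)) (Fin (Λ + 1)) ℂ :=
  (annih Λ).conjTranspose

/-- Operators on (one qubit) ⊗ (mode truncated to at most `Λ` photons), as two-by-two block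
matrices: the left summand is the sector of the qubit state `|0⟩`, the right one that of `|1⟩`. -/
abbrev Op (Λ : ℕ) : Type :=
  Matrix (Fin (Λ + 1) ⊕ Fin (Λ + 1)) (Fin (Λ + 1) ⊕ Fin (Λ + 1)) ℂ

/-- The operator norm induced by the Euclidean (Hilbert space) norm. -/
def opNorm {Λ : ℕ} (M : Op Λ) : ℝ :=
  ‖Matrix.toEuclideanCLM (n := Fin (Λ + 1) ⊕ Fin (Λ + 1)) (𝕜 := ℂ) M‖

/-- `S₁(τ) = exp (i τ [[0, a†], [a, 0]])`. -/
def sOne (Λ : ℕ) (τ : ℝ) : Op Λ :=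
  NormedSpace.exp ((Complex.I * (τ : ℂ)) • (Matrix.fromBlocks 0 (creat Λ) (annih Λ) 0 : Op Λ))

/-- `u ⊗ 1`, the action of a matrix `u` on the qubit alone. -/
def onQubit (Λ : ℕ) (u : Matrix (Fin 2) (Fin 2) ℂ) : Op Λ :=
  Matrix.fromBlocks (u 0 0 • 1) (u 0 1 • 1) (u 1 0 • 1) (u 1 1 • 1)

/-- The instruction set: the entangling gate `S₁(τ)` for any time `τ > 0`, and the
single-qubit gates `X`, `H` (Hadamard), `S` (phase) and `S†`. -/
inductive Gate : Type
  | entangle (τ : ℝ) (hτ : 0 < τ) : Gate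
  | pauliX : Gate
  | hadamard : Gate
  | phase : Gate
  | phaseDagger : Gate

/-- The operator that a gate applies. -/
def Gate.toOp (Λ : ℕ) : Gate → Op Λ
  | .entangle τ _ => sOne Λ τ
  | .pauliX => onQubit Λ !![0, 1; 1, 0]
  | .hadamard => onQubit Λ ((((Real.sqrt 2)⁻¹ : ℝ) : ℂ) • !![1, 1; 1, -1])
  | .phase => onQubit Λ !![1, 0; 0, Complex.I]
  | .phaseDagger => onQubit Λ !![1, 0; 0, -Complex.I]

/-- The number of `S₁` operations that a gate contributes. -/
def Gate.cost : Gate → ℕ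
  | .entangle _ _ => 1
  | _ => 0

/-- The operator implemented by a sequence of gates, as the matrix product in the given order. -/
def circuitOp (Λ : ℕ) (g : List Gate) : Op Λ :=
  (g.map (Gate.toOp Λ)).prod

/-- The number of `S₁` operations in a sequence of gates. -/
def circuitCost (g : List Gate) : ℕ :=
  (g.map Gate.cost).sum

/-- `H = ω a† a + (κ / 2) (a†)² a²`. -/
def hamiltonian (Λ : ℕ) (ω κ : ℝ) : Matrix (Fin (Λ + 1)) (Fin (Λ + 1)) ℂ :=
  (ω : ℂ) • (creat Λ * annih Λ) + ((κ : ℂ) / 2) • (creat Λ ^ 2 * annih Λ ^ 2)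

/-- `K = -(ω a a† + (κ / 2) a² (a†)²)`, the operator in the lower-right block. -/
def lowerBlock (Λ : ℕ) (ω κ : ℝ) : Matrix (Fin (Λ + 1)) (Fin (Λ + 1)) ℂ :=
  -((ω : ℂ) • (annih Λ * creat Λ) + ((κ : ℂ) / 2) • (annih Λ ^ 2 * creat Λ ^ 2))

/-- `exp (i t [[H, 0], [0, K]])`, the exponential of the Hamiltonian block-encoded in the
upper-left block. -/
def blockEvolution (Λ : ℕ) (ω κ t : ℝ) : Op Λ :=
  NormedSpace.exp ((Complex.I * (t : ℂ)) •
    (Matrix.fromBlocks (hamiltonian Λ ω κ) 0 0 (lowerBlock Λ ω κ) : Op Λ))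

/-- The rate `(Λ⁴ max(|ω|,|κ|) t)^(1 + 1/(q - 3/4)) / ε^(1/(q - 3/4))`. -/
def stepRate (q Λ : ℕ) (ω κ t ε : ℝ) : ℝ :=
  ((Λ : ℝ) ^ 4 * max |ω| |κ| * t) ^ (1 + 1 / ((q : ℝ) - 3 / 4)) / ε ^ (1 / ((q : ℝ) - 3 / 4))

end HybridOscillator

end

/-! Conjugation by the qubit gates is free and turns the generator of `sOne` into a stock of
skew-adjoint letters. Group commutators of their flows produce, to leading order, i times a multiple
of `quadraticTerm` at order 2 and of `quarticTerm` at order 4 (`generates_quadraticTerm`,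
`generates_quarticTerm`). The identities are purely algebraic in the creation and annihilation
matrices, so the truncation, which breaks the canonical commutation relation, does no harm.

From a word `w` with leading term `B` of order `k`, the product `w(cz) w(cz) w(dz)⁻¹` with suitable
real `c`, `d` keeps `B` and removes the lowest error term. Each round triples the length and raises
the order by one (`exists_word_of_order`). Remainders are entire functions, so the maximum principle
on a circle of radius about 1/(total size of the letters) gives explicit bounds with constants
independent of `Λ` (`exists_product_formula`).

The two terms are diagonal in the Fock basis and commute, so the evolution is exactly an `R`-th
power of a product of two short exponentials. A segment of effective size `y` has error of order `y
^ (q + 1/4)`, where `y` is proportional to `1/R`. Summing over `R` segments leaves the power `q -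
3/4` of `1/R`, which is the exponent in the rate. The factor `Λ⁴` is the fourth power of the bound
`2Λ` on the letters. All constants exponential in `q` are moved into `R = r B ^ q`, and from there
into `e ^ (cq)`. -/

namespace HybridOscillator

/-! ### Words in exponentials -/

section ExponentialWords

open NormedSpace

variable {𝔸 : Type*} [NormedRing 𝔸] [NormedAlgebra ℂ 𝔸]

/-- `F` and `G` agree up to `z ^ m • E` and an entire remainder of order `m + 1`. -/
def LeadingError (m : ℕ) (E : 𝔸) (F G : ℂ → 𝔸) : Prop :=
  ∃ g : ℂ → 𝔸, Differentiable ℂ g ∧ g 0 = E ∧ ∀ z, F z = G z + z ^ m • g z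

/-- The product of exponentials `∏ exp (z • X)` over the letters `X` of a word. -/
noncomputable def evalWord (w : List 𝔸) (z : ℂ) : 𝔸 := (w.map fun X => exp (z • X)).prod

theorem norm_exp_le_exp_norm [CompleteSpace 𝔸] [NormOneClass 𝔸] (x : 𝔸) :
    ‖exp x‖ ≤ Real.exp ‖x‖ := by
  rw [exp_eq_tsum ℂ, Real.exp_eq_exp_ℝ, exp_eq_tsum ℝ]
  refine tsum_of_norm_bounded (expSeries_summable' (𝕂 := ℝ) ‖x‖).hasSum fun n => ?_
  rw [norm_smul, norm_inv, Complex.norm_natCast, smul_eq_mul]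
  gcongr
  exact norm_pow_le x n

theorem norm_exp_smul_le [CompleteSpace 𝔸] [NormOneClass 𝔸] {z : ℂ} {X : 𝔸} {ρ b : ℝ}
    (hz : ‖z‖ ≤ ρ) (hX : ‖X‖ ≤ b) : ‖exp (z • X)‖ ≤ Real.exp (ρ * b) := by
  refine (norm_exp_le_exp_norm _).trans (Real.exp_le_exp.2 ?_)
  rw [norm_smul]
  exact mul_le_mul hz hX (norm_nonneg _) ((norm_nonneg _).trans hz)

theorem norm_evalWord_le [CompleteSpace 𝔸] [NormOneClass 𝔸] {w : List 𝔸} {z : ℂ} {ρ b : ℝ}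
    (hz : ‖z‖ ≤ ρ) (hw : ∀ X ∈ w, ‖X‖ ≤ b) :
    ‖evalWord w z‖ ≤ Real.exp (w.length * (ρ * b)) := by
  induction w with
  | nil => simp [evalWord]
  | cons X w ih =>
    have h1 := norm_exp_smul_le hz (hw X (by simp))
    have h2 := ih fun Y hY => hw Y (by simp [hY])
    calc ‖evalWord (X :: w) z‖ = ‖exp (z • X) * evalWord w z‖ := by simp [evalWord]
      _ ≤ Real.exp (ρ * b) * Real.exp (w.length * (ρ * b)) :=
        (norm_mul_le _ _).trans (mul_le_mul h1 h2 (norm_nonneg _) (Real.exp_nonneg _))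
      _ = _ := by rw [← Real.exp_add]; congr 1; push_cast [List.length_cons]; ring

theorem evalWord_append (v w : List 𝔸) (z : ℂ) :
    evalWord (v ++ w) z = evalWord v z * evalWord w z := by
  simp [evalWord]

theorem evalWord_zero (w : List 𝔸) : evalWord w 0 = 1 := by
  simp [evalWord]

theorem evalWord_smul (c : ℂ) (w : List 𝔸) (z : ℂ) :
    evalWord (w.map (c • ·)) z = evalWord w (c * z) := by
  simp [evalWord, Function.comp_def, smul_smul, mul_comm]

theorem exp_smul_mul_exp_smul_neg [CompleteSpace 𝔸] (z : ℂ) (X : 𝔸) :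
    exp (z • X) * exp (z • -X) = 1 := by
  let _ := NormedAlgebra.restrictScalars ℚ ℂ 𝔸
  rw [smul_neg, ← exp_add_of_commute (Commute.neg_right (Commute.refl _))]
  simp

theorem evalWord_mul_inverse [CompleteSpace 𝔸] (w : List 𝔸) (z : ℂ) :
    evalWord w z * evalWord (w.reverse.map (- ·)) z = 1 := by
  induction w with
  | nil => simp [evalWord]
  | cons X w ih =>
    rw [List.reverse_cons, List.map_append, evalWord_append]
    have : evalWord (X :: w) z = exp (z • X) * evalWord w z := by simp [evalWord]
    rw [this, mul_assoc, ← mul_assoc (evalWord w z), ih, one_mul]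
    simpa [evalWord] using exp_smul_mul_exp_smul_neg z X

theorem differentiable_evalWord [CompleteSpace 𝔸] (w : List 𝔸) :
    Differentiable ℂ (evalWord w) := by
  induction w with
  | nil =>
    have : evalWord ([] : List 𝔸) = fun _ => 1 := by ext; simp [evalWord]
    rw [this]; exact differentiable_const _
  | cons X w ih =>
    have : evalWord (X :: w) = fun z => exp (z • X) * evalWord w z := by ext; simp [evalWord]
    rw [this]
    exact (differentiable_exp_smul_const ℂ X).mul ih

theorem evalWord_conj [CompleteSpace 𝔸] (u : 𝔸ˣ) (w : List 𝔸) (z : ℂ) :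
    evalWord (w.map fun X => (u : 𝔸) * X * (u⁻¹ : 𝔸ˣ)) z = u * evalWord w z * (u⁻¹ : 𝔸ˣ) := by
  let _ := NormedAlgebra.restrictScalars ℚ ℂ 𝔸
  induction w with
  | nil => simp [evalWord]
  | cons X w ih =>
    have h (Y : 𝔸) (v : List 𝔸) : evalWord (Y :: v) z = exp (z • Y) * evalWord v z := by
      simp [evalWord]
    rw [List.map_cons, h, ih, h, ← smul_mul_assoc, ← mul_smul_comm, exp_units_conj]
    simp [mul_assoc]

/-- The difference quotient at 0 has a removable singularity. Entire remainders replace Taylor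
expansions throughout. -/
theorem exists_entire_quotient [CompleteSpace 𝔸] {g : ℂ → 𝔸} (hg : Differentiable ℂ g) :
    ∃ h : ℂ → 𝔸, Differentiable ℂ h ∧ ∀ z, g z = g 0 + z • h z := by
  refine ⟨dslope g 0, ?_, fun z => ?_⟩
  · rw [← differentiableOn_univ, Complex.differentiableOn_dslope Filter.univ_mem]
    exact hg.differentiableOn
  · have := sub_smul_dslope g 0 z
    rw [sub_zero] at this
    rw [this]; abel

/-! ### Calculus of leading error terms -/

namespace LeadingError

variable {m k l : ℕ} {E B C : 𝔸} {F G F₁ F₂ G₁ G₂ : ℂ → 𝔸}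

theorem succ [CompleteSpace 𝔸] (h : LeadingError m 0 F G) :
    ∃ E, LeadingError (m + 1) E F G := by
  obtain ⟨g, hg, h0, h⟩ := h
  obtain ⟨f, hf, hgf⟩ := exists_entire_quotient hg
  refine ⟨f 0, f, hf, rfl, fun z => ?_⟩
  rw [h, hgf, h0, zero_add, smul_smul, pow_succ]

theorem sub (h₁ : LeadingError m B F₁ G) (h₂ : LeadingError m C F₂ G) :
    LeadingError m (B - C) F₁ F₂ := by
  obtain ⟨g, hg, rfl, h⟩ := h₁
  obtain ⟨f, hf, rfl, h'⟩ := h₂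
  refine ⟨fun z => g z - f z, hg.sub hf, rfl, fun z => ?_⟩
  rw [h, h', smul_sub]; abel

theorem mul (h₁ : LeadingError m B F₁ G₁) (h₂ : LeadingError m C F₂ G₂)
    (hF : Differentiable ℂ F₂) (hG : Differentiable ℂ G₁) (hF0 : F₂ 0 = 1) (hG0 : G₁ 0 = 1) :
    LeadingError m (B + C) (fun z => F₁ z * F₂ z) (fun z => G₁ z * G₂ z) := by
  obtain ⟨g, hg, rfl, h⟩ := h₁
  obtain ⟨f, hf, rfl, h'⟩ := h₂
  refine ⟨fun z => g z * F₂ z + G₁ z * f z, (hg.mul hF).add (hG.mul hf), by simp [hF0, hG0],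
    fun z => ?_⟩
  change F₁ z * F₂ z = G₁ z * G₂ z + z ^ m • (g z * F₂ z + G₁ z * f z)
  rw [h, add_mul, h']
  simp only [mul_add, smul_add, smul_mul_assoc, mul_smul_comm]
  abel

theorem inv (h : LeadingError m B F₁ G₁) (hF : ∀ z, F₂ z * F₁ z = 1) (hG : ∀ z, G₁ z * G₂ z = 1)
    (dF : Differentiable ℂ F₂) (dG : Differentiable ℂ G₂) (hF0 : F₂ 0 = 1) (hG0 : G₂ 0 = 1) :
    LeadingError m (-B) F₂ G₂ := by
  obtain ⟨g, hg, rfl, h⟩ := h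
  refine ⟨fun z => -(F₂ z * g z * G₂ z), ((dF.mul hg).mul dG).neg, by simp [hF0, hG0],
    fun z => ?_⟩
  have h1 : F₂ z * F₁ z * G₂ z = G₂ z := by rw [hF, one_mul]
  rw [h, mul_add, add_mul, mul_assoc, hG, mul_one] at h1
  rw [← eq_sub_iff_add_eq] at h1
  rw [h1]
  simp [sub_eq_add_neg]

theorem comp_smul (h : LeadingError m B F G) (c : ℂ) :
    LeadingError m (c ^ m • B) (fun z => F (c * z)) (fun z => G (c * z)) := by
  obtain ⟨g, hg, rfl, h⟩ := h
  refine ⟨fun z => c ^ m • g (c * z), ?_, by simp, fun z => ?_⟩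
  · exact (hg.comp (differentiable_id.const_mul c) : Differentiable ℂ fun z => g (c * z)).const_smul (c ^ m)
  · beta_reduce
    rw [h, mul_pow, smul_smul, mul_comm (c ^ m)]

/-- With `V = 1 + z^k g` and `W = 1 + z^l f`, the difference `VW - WV` is exactly `z^(k+l) (gf -
fg)`; multiplying by the inverse of `WV` gives the group commutator minus 1. -/
theorem commutator {V W V' W' : ℂ → 𝔸} (hV : LeadingError k B V 1) (hW : LeadingError l C W 1)
    (dV : Differentiable ℂ V') (dW : Differentiable ℂ W') (hV0 : V' 0 = 1) (hW0 : W' 0 = 1)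
    (hVV : ∀ z, V z * V' z = 1) (hWW : ∀ z, W z * W' z = 1) :
    LeadingError (k + l) (B * C - C * B) (fun z => V z * W z * (V' z * W' z)) 1 := by
  obtain ⟨g, hg, rfl, hg'⟩ := hV
  obtain ⟨f, hf, rfl, hf'⟩ := hW
  refine ⟨fun z => (g z * f z - f z * g z) * (V' z * W' z),
    ((hg.mul hf).sub (hf.mul hg)).mul (dV.mul dW), by simp [hV0, hW0], fun z => ?_⟩
  have h1 : W z * V z * (V' z * W' z) = 1 := by
    rw [mul_assoc, ← mul_assoc (V z), hVV, one_mul, hWW]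
  have h2 : V z * W z = W z * V z + z ^ (k + l) • (g z * f z - f z * g z) := by
    rw [hg', hf']
    simp only [Pi.one_apply, add_mul, mul_add, one_mul, mul_one, smul_mul_assoc, mul_smul_comm,
      smul_add, smul_smul, pow_add, smul_sub, mul_comm (z ^ l) (z ^ k)]
    abel
  beta_reduce
  rw [h2, add_mul, h1, smul_mul_assoc]; rfl

theorem conj (h : LeadingError m B F 1) (u : 𝔸ˣ) :
    LeadingError m (u * B * (u⁻¹ : 𝔸ˣ)) (fun z => u * F z * (u⁻¹ : 𝔸ˣ)) 1 := by
  obtain ⟨g, hg, rfl, h⟩ := h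
  refine ⟨fun z => u * g z * (u⁻¹ : 𝔸ˣ), (hg.const_mul _).mul_const _, rfl, fun z => ?_⟩
  beta_reduce
  rw [h]
  simp [mul_add, add_mul]

/-- Schwarz-type estimate: the order of vanishing turns a bound on a circle into one inside. -/
theorem norm_sub_le (h : LeadingError m E F G) {ρ S : ℝ} (hρ : 0 < ρ)
    (hS : ∀ z : ℂ, ‖z‖ = ρ → ‖F z - G z‖ ≤ S) {z : ℂ} (hz : ‖z‖ ≤ ρ) :
    ‖F z - G z‖ ≤ (‖z‖ / ρ) ^ m * S ∧ ‖E‖ ≤ S / ρ ^ m := by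
  obtain ⟨g, hg, rfl, h⟩ := h
  have key : ∀ z : ℂ, ‖z‖ ≤ ρ → ‖g z‖ ≤ S / ρ ^ m := by
    intro z hz
    refine Complex.norm_le_of_forall_mem_frontier_norm_le (U := Metric.ball (0 : ℂ) ρ)
      Metric.isBounded_ball hg.diffContOnCl (fun w hw => ?_) ?_
    · rw [frontier_ball _ hρ.ne', mem_sphere_zero_iff_norm] at hw
      have := hS w hw
      rw [h, add_sub_cancel_left, norm_smul, norm_pow, hw] at this
      rwa [le_div_iff₀ (by positivity), mul_comm]
    · rw [closure_ball _ hρ.ne']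
      simpa using hz
  refine ⟨?_, key 0 (by simpa using hρ.le)⟩
  rw [h, add_sub_cancel_left, norm_smul, norm_pow, div_pow, div_mul_eq_mul_div, mul_div_assoc]
  exact mul_le_mul_of_nonneg_left (key z hz) (by positivity)

end LeadingError

theorem differentiable_exp_pow_smul [CompleteSpace 𝔸] (k : ℕ) (B : 𝔸) :
    Differentiable ℂ fun z : ℂ => exp (z ^ k • B) :=
  (differentiable_exp_smul_const ℂ B).comp (differentiable_id.pow k)

theorem leadingError_exp [CompleteSpace 𝔸] {k : ℕ} (hk : k ≠ 0) (B : 𝔸) :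
    LeadingError k B (fun z => exp (z ^ k • B)) 1 := by
  obtain ⟨h, hh, h'⟩ := exists_entire_quotient (differentiable_exp_smul_const ℂ B)
  refine ⟨fun z => h (z ^ k), hh.comp (differentiable_id.pow k), ?_, fun z => ?_⟩
  · have h1 : HasDerivAt (fun z : ℂ => exp (z • B)) B 0 := by
      simpa using hasDerivAt_exp_smul_const (𝕂 := ℂ) B 0
    have h2 : HasDerivAt (fun z : ℂ => exp (z • B)) (h 0) 0 := by
      have h3 : (fun z : ℂ => exp (z • B)) = fun z => 1 + z • h z := by
        ext z; simpa using h' z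
      rw [h3]
      simpa using ((hasDerivAt_id (0 : ℂ)).smul (hh 0).hasDerivAt).const_add 1
    have h4 : h (0 ^ k) = h 0 := by rw [zero_pow hk]
    exact h4.trans (h2.unique h1)
  · simpa using h' (z ^ k)

/-! ### Words over an alphabet and the elements they generate -/

/-- The letters of `w` are real multiples, by factors of size at most `Γ`, of elements of `𝒜`. -/
def HasLetters (𝒜 : Set 𝔸) (Γ : ℝ) (w : List 𝔸) : Prop :=
  ∀ X ∈ w, ∃ c : ℝ, |c| ≤ Γ ∧ ∃ Y ∈ 𝒜, X = (c : ℂ) • Y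

theorem HasLetters.append {𝒜 : Set 𝔸} {Γ : ℝ} {v w : List 𝔸} (hv : HasLetters 𝒜 Γ v)
    (hw : HasLetters 𝒜 Γ w) : HasLetters 𝒜 Γ (v ++ w) := by
  intro X hX
  rcases List.mem_append.1 hX with h | h
  exacts [hv X h, hw X h]

theorem HasLetters.inverse {𝒜 : Set 𝔸} {Γ : ℝ} {w : List 𝔸} (hw : HasLetters 𝒜 Γ w) :
    HasLetters 𝒜 Γ (w.reverse.map (- ·)) := by
  intro X hX
  obtain ⟨Y, hY, rfl⟩ := List.mem_map.1 hX
  obtain ⟨c, hc, Z, hZ, rfl⟩ := hw Y (List.mem_reverse.1 hY)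
  exact ⟨-c, by simpa using hc, Z, hZ, by simp⟩

theorem HasLetters.smul {𝒜 : Set 𝔸} {Γ d γ : ℝ} {w : List 𝔸} (hw : HasLetters 𝒜 Γ w)
    (hd : |d| ≤ γ) : HasLetters 𝒜 (γ * Γ) (w.map ((d : ℂ) • ·)) := by
  intro X hX
  obtain ⟨Y, hY, rfl⟩ := List.mem_map.1 hX
  obtain ⟨c, hc, Z, hZ, rfl⟩ := hw Y hY
  refine ⟨d * c, ?_, Z, hZ, by simp [mul_smul]⟩
  rw [abs_mul]
  exact mul_le_mul hd hc (abs_nonneg _) ((abs_nonneg _).trans hd)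

theorem HasLetters.norm_le {𝒜 : Set 𝔸} {Γ a : ℝ} {w : List 𝔸} (hw : HasLetters 𝒜 Γ w)
    (h𝒜 : ∀ Y ∈ 𝒜, ‖Y‖ ≤ a) : ∀ X ∈ w, ‖X‖ ≤ Γ * a := by
  intro X hX
  obtain ⟨c, hc, Y, hY, rfl⟩ := hw X hX
  rw [norm_smul, Complex.norm_real, Real.norm_eq_abs]
  exact mul_le_mul hc (h𝒜 Y hY) (norm_nonneg _) ((abs_nonneg _).trans hc)

/-- `B` is the term of order `k` of a word with at most `N` letters from `±𝒜`. -/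
def Generates (𝒜 : Set 𝔸) (k N : ℕ) (B : 𝔸) : Prop :=
  ∃ w, HasLetters 𝒜 1 w ∧ w.length ≤ N ∧ LeadingError k B (evalWord w) 1

namespace Generates

variable [CompleteSpace 𝔸] {𝒜 : Set 𝔸} {k l N M : ℕ} {B C : 𝔸}

theorem of_mem (hB : B ∈ 𝒜) : Generates 𝒜 1 1 B := by
  refine ⟨[B], fun X hX => ⟨1, by simp, B, hB, by simpa using hX⟩, by simp, ?_⟩
  have h : evalWord [B] = fun z : ℂ => exp (z ^ 1 • B) := by ext; simp [evalWord]
  rw [h]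
  exact leadingError_exp one_ne_zero B

theorem add (hB : Generates 𝒜 k N B) (hC : Generates 𝒜 k M C) :
    Generates 𝒜 k (N + M) (B + C) := by
  obtain ⟨v, hv, hvN, h⟩ := hB
  obtain ⟨w, hw, hwM, h'⟩ := hC
  refine ⟨v ++ w, hv.append hw, by simpa using add_le_add hvN hwM, ?_⟩
  have h2 := h.mul h' (differentiable_evalWord w) (differentiable_const 1) (evalWord_zero w) rfl
  simpa [funext (evalWord_append v w), Pi.one_def] using h2

theorem neg (hB : Generates 𝒜 k N B) : Generates 𝒜 k N (-B) := by
  obtain ⟨w, hw, hN, h⟩ := hB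
  refine ⟨w.reverse.map (- ·), hw.inverse, by simpa using hN, ?_⟩
  refine h.inv (fun z => ?_) (by simp) (differentiable_evalWord _) (differentiable_const 1)
    (evalWord_zero _) rfl
  simpa [← List.map_reverse, Function.comp_def] using evalWord_mul_inverse (w.reverse.map (- ·)) z

theorem sub (hB : Generates 𝒜 k N B) (hC : Generates 𝒜 k M C) :
    Generates 𝒜 k (N + M) (B - C) := by
  rw [sub_eq_add_neg]; exact hB.add hC.neg

theorem commutator (hB : Generates 𝒜 k N B) (hC : Generates 𝒜 l M C) :
    Generates 𝒜 (k + l) (2 * (N + M)) (B * C - C * B) := by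
  obtain ⟨v, hv, hvN, h⟩ := hB
  obtain ⟨w, hw, hwM, h'⟩ := hC
  refine ⟨v ++ w ++ (v.reverse.map (- ·) ++ w.reverse.map (- ·)),
    (hv.append hw).append (hv.inverse.append hw.inverse), by simp; omega, ?_⟩
  have h2 := h.commutator h' (differentiable_evalWord (v.reverse.map (- ·)))
    (differentiable_evalWord (w.reverse.map (- ·))) (evalWord_zero _) (evalWord_zero _)
    (evalWord_mul_inverse v) (evalWord_mul_inverse w)
  convert h2 using 1
  ext z
  simp only [evalWord_append]

/-- The conjugation is carried out letter by letter inside the alphabet, so the length does not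
grow. -/
theorem conj (hB : Generates 𝒜 k N B) (u : 𝔸ˣ)
    (hu : ∀ X ∈ 𝒜, (u : 𝔸) * X * (u⁻¹ : 𝔸ˣ) ∈ 𝒜) :
    Generates 𝒜 k N (u * B * (u⁻¹ : 𝔸ˣ)) := by
  obtain ⟨w, hw, hN, h⟩ := hB
  refine ⟨w.map fun X => (u : 𝔸) * X * (u⁻¹ : 𝔸ˣ), fun X hX => ?_, by simpa using hN, ?_⟩
  · obtain ⟨Y, hY, rfl⟩ := List.mem_map.1 hX
    obtain ⟨c, hc, Z, hZ, rfl⟩ := hw Y hY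
    exact ⟨c, hc, _, hu Z hZ, by simp⟩
  · rw [funext (evalWord_conj u w)]
    exact h.conj u

end Generates

/-! ### Product formulas of arbitrary order -/

/-- Real scalings that cancel a term of order `m` and preserve the term of order `k < m`. -/
theorem exists_cancelling_scales {k : ℕ} (hk : k ≠ 0) :
    ∃ γ : ℝ, 1 ≤ γ ∧ ∀ m, k < m → ∃ c d : ℝ, |c| ≤ γ ∧ |d| ≤ γ ∧
      2 * c ^ k - d ^ k = 1 ∧ 2 * c ^ m - d ^ m = 0 := by
  -- With `d = 2^(1/m) c`, the condition at order `k` reads `c^k (2 - 2^(k/m)) = 1`. The worst case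
  -- is `m = k + 1`, where `2^(k/m) = θ < 2`; hence `γ` does not depend on `m`, and `j` rounds cost
  -- only `γ ^ j`.
  set θ : ℝ := 2 ^ ((k : ℝ) / (k + 1)) with hθ
  have hk0 : (0 : ℝ) < k := by exact_mod_cast Nat.pos_of_ne_zero hk
  have hθ2 : θ < 2 := by
    calc θ < 2 ^ (1 : ℝ) := Real.rpow_lt_rpow_of_exponent_lt (by norm_num)
          (by rw [div_lt_one (by positivity)]; linarith)
      _ = 2 := Real.rpow_one 2
  have hθ1 : 1 ≤ θ := Real.one_le_rpow (by norm_num) (by positivity)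
  have hb : (1 : ℝ) ≤ 1 / (2 - θ) := by
    rw [le_div_iff₀ (by linarith)]; linarith
  refine ⟨2 * (1 / (2 - θ)), by linarith, fun m hm => ?_⟩
  have hm0 : (0 : ℝ) < m := by exact_mod_cast (Nat.zero_le k).trans_lt hm
  set δ : ℝ := 2 ^ (1 / (m : ℝ)) with hδ
  have hδm : δ ^ m = 2 := by
    rw [hδ, ← Real.rpow_natCast, ← Real.rpow_mul (by norm_num), one_div,
      inv_mul_cancel₀ hm0.ne', Real.rpow_one]
  have hδk : δ ^ k ≤ θ := by
    rw [hδ, ← Real.rpow_natCast, ← Real.rpow_mul (by norm_num), hθ]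
    refine Real.rpow_le_rpow_of_exponent_le (by norm_num) ?_
    rw [one_div_mul_eq_div]
    gcongr
    exact_mod_cast hm
  have hδ0 : 0 < δ := by positivity
  have hδ2 : δ ≤ 2 := by
    calc δ ≤ 2 ^ (1 : ℝ) := Real.rpow_le_rpow_of_exponent_le (by norm_num) (by
          rw [div_le_one hm0]; exact_mod_cast (Nat.zero_le k).trans_lt hm)
      _ = 2 := Real.rpow_one 2
  have hpos : 0 < 1 / (2 - δ ^ k) := by
    have : 0 < 2 - δ ^ k := by linarith
    positivity
  set c : ℝ := (1 / (2 - δ ^ k)) ^ (1 / (k : ℝ)) with hc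
  have hc0 : 0 < c := by positivity
  have hck : c ^ k = 1 / (2 - δ ^ k) := by
    rw [hc, ← Real.rpow_natCast, ← Real.rpow_mul hpos.le, one_div (k : ℝ),
      inv_mul_cancel₀ hk0.ne', Real.rpow_one]
  have hcb : c ≤ 1 / (2 - θ) := by
    by_contra! hlt
    have h1 : 1 / (2 - θ) < c ^ k := hlt.trans_le (le_self_pow₀ (hb.trans hlt.le) hk)
    rw [hck] at h1
    exact absurd h1 (not_lt.2 (one_div_le_one_div_of_le (by linarith) (by linarith)))
  refine ⟨c, δ * c, ?_, ?_, ?_, ?_⟩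
  · rw [abs_of_pos hc0]; linarith
  · rw [abs_of_pos (by positivity)]
    exact mul_le_mul hδ2 hcb hc0.le (by norm_num)
  · rw [mul_pow, ← sub_mul, hck]
    exact mul_one_div_cancel (by linarith)
  · rw [mul_pow, hδm]; ring

/-- The generating word and `exp (z ^ k • B)` share the term of order `k`, so they already agree to
one order more. Each further round uses `w(cz) w(cz) w(dz)⁻¹`: the targets commute and multiply back
to the same exponential, while the leading errors add up to zero. -/
theorem exists_word_of_order [CompleteSpace 𝔸] {k : ℕ} {γ : ℝ}
    (hγ : ∀ m, k < m → ∃ c d : ℝ, |c| ≤ γ ∧ |d| ≤ γ ∧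
      2 * c ^ k - d ^ k = 1 ∧ 2 * c ^ m - d ^ m = 0)
    (hk : k ≠ 0) {𝒜 : Set 𝔸} {N : ℕ} {B : 𝔸} (hB : Generates 𝒜 k N B) (j : ℕ) :
    ∃ w E, HasLetters 𝒜 (γ ^ j) w ∧ w.length ≤ N * 3 ^ j ∧
      LeadingError (k + 1 + j) E (evalWord w) (fun z => exp (z ^ k • B)) := by
  induction j with
  | zero =>
    obtain ⟨w, hw, hN, h⟩ := hB
    have h0 := h.sub (leadingError_exp hk B)
    rw [sub_self] at h0
    obtain ⟨E, hE⟩ := h0.succ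
    exact ⟨w, E, by simpa using hw, by simpa using hN, hE⟩
  | succ j ih =>
    let _ := NormedAlgebra.restrictScalars ℚ ℂ 𝔸
    obtain ⟨w, E, hw, hN, h⟩ := ih
    obtain ⟨c, d, hc, hd, h1, h0⟩ := hγ (k + 1 + j) (by omega)
    let v := w.map ((c : ℂ) • ·)
    let u := w.map ((d : ℂ) • ·)
    have hv := h.comp_smul c
    have hu := h.comp_smul d
    rw [← funext (evalWord_smul (c : ℂ) w)] at hv
    rw [← funext (evalWord_smul (d : ℂ) w)] at hu
    have hu' := hu.inv (F₂ := evalWord (u.reverse.map (- ·)))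
      (G₂ := fun z => exp (((d : ℂ) * z) ^ k • -B))
      (fun z => by
        simpa [u, ← List.map_reverse, Function.comp_def] using
          evalWord_mul_inverse (u.reverse.map (- ·)) z)
      (fun z => exp_smul_mul_exp_smul_neg _ _) (differentiable_evalWord _)
      ((differentiable_exp_pow_smul k (-B)).comp (differentiable_id.const_mul _))
      (evalWord_zero _) (by simp [hk])
    have dG : Differentiable ℂ fun z : ℂ => exp (((c : ℂ) * z) ^ k • B) :=
      (differentiable_exp_pow_smul k B).comp (differentiable_id.const_mul _)
    have h3 := (hv.mul hv (differentiable_evalWord v) dG (evalWord_zero v)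
      (by simp [hk])).mul hu' (differentiable_evalWord _) (dG.mul dG) (evalWord_zero _)
      (by simp [hk])
    have hE : ((c : ℂ) ^ (k + 1 + j) • E + (c : ℂ) ^ (k + 1 + j) • E
        + -((d : ℂ) ^ (k + 1 + j) • E)) = 0 := by
      rw [← add_smul, ← sub_eq_add_neg, ← sub_smul]
      have : ((2 * c ^ (k + 1 + j) - d ^ (k + 1 + j) : ℝ) : ℂ) = 0 := by rw [h0]; simp
      push_cast at this
      rw [← two_mul, this, zero_smul]
    rw [hE] at h3
    have hG : (fun z : ℂ => exp (((c : ℂ) * z) ^ k • B) * exp (((c : ℂ) * z) ^ k • B)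
        * exp (((d : ℂ) * z) ^ k • -B)) = fun z => exp (z ^ k • B) := by
      ext z
      have hcom (x y : ℂ) (A : 𝔸) : Commute (x • A) (y • A) :=
        ((Commute.refl A).smul_left x).smul_right y
      rw [smul_neg, ← neg_smul, ← exp_add_of_commute (hcom _ _ B), ← add_smul,
        ← exp_add_of_commute (hcom _ _ B), ← add_smul]
      congr 2
      have : ((2 * c ^ k - d ^ k : ℝ) : ℂ) = 1 := by rw [h1]; simp
      push_cast at this
      linear_combination z ^ k * this
    rw [hG] at h3
    obtain ⟨E', h4⟩ := h3.succ
    refine ⟨v ++ v ++ u.reverse.map (- ·), E', ?_, ?_, ?_⟩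
    · rw [pow_succ']
      exact ((hw.smul hc).append (hw.smul hc)).append (hw.smul hd).inverse
    · simp only [v, u, List.length_append, List.length_map, List.length_reverse, pow_succ]
      rw [← mul_assoc]
      omega
    · rw [show k + 1 + (j + 1) = k + 1 + j + 1 by ring]
      convert h4 using 1
      ext z
      simp only [evalWord_append, v]

/-- Product formulas of arbitrary order: with `K ^ (j + 1)` letters, the exponential of a generated
element is approximated to order `k + 1 + j`, with constants that depend only on `k` and `N`. -/
theorem exists_product_formula.{u} {k : ℕ} (hk : k ≠ 0) (N : ℕ) :
    ∃ K : ℕ, 1 ≤ K ∧ ∀ (𝔸 : Type u) [NormedRing 𝔸] [NormedAlgebra ℂ 𝔸] [CompleteSpace 𝔸]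
      [NormOneClass 𝔸] (𝒜 : Set 𝔸) (a : ℝ) (B : 𝔸), 0 < a → (∀ Y ∈ 𝒜, ‖Y‖ ≤ a) →
      Generates 𝒜 k N B → ∀ j, ∃ w Γ, HasLetters 𝒜 Γ w ∧ w.length ≤ K ^ (j + 1) ∧
        ∀ s : ℝ, 0 ≤ s → K ^ (j + 1) * a * s ≤ 1 →
          ‖evalWord w s - exp ((s : ℂ) ^ k • B)‖ ≤ K * (K ^ (j + 1) * a * s) ^ (k + 1 + j) := by
  obtain ⟨γ, hγ1, hγ⟩ := exists_cancelling_scales hk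
  set S : ℝ := Real.exp 1 + Real.exp (Real.exp 1 + 1) with hS
  -- After `j` rounds, length times coefficient size is at most `N (3γ) ^ j`, which `K ^ (j + 1)`
  -- dominates; `K ≥ S` also absorbs the bound on the circle.
  obtain ⟨K, hK⟩ := exists_nat_ge (3 * γ * (N + 1) + S)
  have hS0 : 0 < S := by positivity
  have hN0 : (0 : ℝ) ≤ N := by positivity
  have hKN : (3 : ℝ) * γ * (N + 1) ≤ K := by linarith
  have h3γ : 3 * γ ≤ K := by nlinarith
  have hK1 : (1 : ℝ) ≤ K := by linarith
  have hKN' : (N : ℝ) ≤ K := by nlinarith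
  have hlen (j : ℕ) : (N : ℝ) * (3 * γ) ^ j ≤ K ^ (j + 1) := by
    rw [pow_succ']
    exact mul_le_mul hKN' (pow_le_pow_left₀ (by positivity) h3γ j) (by positivity) (by linarith)
  refine ⟨K, by exact_mod_cast hK1, fun 𝔸 _ _ _ _ 𝒜 a B ha h𝒜 hB j => ?_⟩
  obtain ⟨w, E, hw, hN, h⟩ := exists_word_of_order hγ hk hB j
  refine ⟨w, γ ^ j, hw, ?_, fun s hs hs1 => ?_⟩
  · have h1 : (N : ℝ) * 3 ^ j ≤ K ^ (j + 1) := by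
      refine le_trans ?_ (hlen j)
      gcongr
      linarith
    exact hN.trans (by exact_mod_cast h1)
  -- On this radius the norms of all exponents in the word sum to at most 1, so the word is bounded
  -- by `e`.
  set ρ : ℝ := 1 / (K ^ (j + 1) * a) with hρ
  have hρ0 : 0 < ρ := by positivity
  have hρ1 : K ^ (j + 1) * (ρ * a) = 1 := by rw [hρ]; field_simp
  have hNρ : (N : ℝ) * (ρ * a) ≤ 1 := by
    rw [← hρ1]
    refine mul_le_mul_of_nonneg_right (hKN'.trans (le_self_pow₀ hK1 (by omega))) (by positivity)
  -- The size of `B` is controlled by a Cauchy estimate for the word that generates it.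
  have hBρ : ρ ^ k * ‖B‖ ≤ Real.exp 1 + 1 := by
    obtain ⟨v, hv, hvN, hB⟩ := hB
    have h2 := (hB.norm_sub_le (S := Real.exp 1 + 1) hρ0 (fun z hz => ?_) (z := 0)
      (by simpa using hρ0.le)).2
    · rwa [le_div_iff₀ (by positivity), mul_comm] at h2
    · refine (norm_sub_le _ _).trans (add_le_add ?_ (by simp))
      refine (norm_evalWord_le hz.le (hv.norm_le h𝒜)).trans (Real.exp_le_exp.2 ?_)
      refine le_trans ?_ hNρ
      rw [one_mul]
      gcongr
  have hcirc : ∀ z : ℂ, ‖z‖ = ρ → ‖evalWord w z - exp (z ^ k • B)‖ ≤ S := by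
    intro z hz
    refine (norm_sub_le _ _).trans (add_le_add ?_ ?_)
    · refine (norm_evalWord_le hz.le (hw.norm_le h𝒜)).trans (Real.exp_le_exp.2 ?_)
      calc (w.length : ℝ) * (ρ * (γ ^ j * a)) ≤ (N * 3 ^ j : ℝ) * (ρ * (γ ^ j * a)) := by
            gcongr; exact_mod_cast hN
        _ = N * (3 * γ) ^ j * (ρ * a) := by rw [mul_pow]; ring
        _ ≤ K ^ (j + 1) * (ρ * a) := mul_le_mul_of_nonneg_right (hlen j) (by positivity)
        _ = 1 := hρ1
    · refine (norm_exp_smul_le (ρ := ρ ^ k) (by rw [norm_pow, hz]) le_rfl).trans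
        (Real.exp_le_exp.2 hBρ)
  have hsn : ‖(s : ℂ)‖ = s := by simp [abs_of_nonneg hs]
  have hsρ : ‖(s : ℂ)‖ ≤ ρ := by
    rw [hsn, hρ, le_div_iff₀ (by positivity), mul_comm]; exact hs1
  refine (h.norm_sub_le hρ0 hcirc hsρ).1.trans ?_
  have h5 : ‖(s : ℂ)‖ / ρ = K ^ (j + 1) * a * s := by rw [hsn, hρ]; field_simp
  rw [h5, mul_comm]
  gcongr
  nlinarith

end ExponentialWords

/-! ### Circuits and their free conjugations -/

section Circuits

open NormedSpace Matrix
open scoped Matrix.Norms.L2Operator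

variable {Λ : ℕ}

theorem opNorm_eq_norm (M : Op Λ) : opNorm M = ‖M‖ := rfl

/-- `U` is the operator of a circuit with at most `n` entangling gates. -/
def Implementable (n : ℕ) (U : Op Λ) : Prop :=
  ∃ g, circuitOp Λ g = U ∧ circuitCost g ≤ n

namespace Implementable

theorem one : Implementable 0 (1 : Op Λ) := ⟨[], by simp [circuitOp], by simp [circuitCost]⟩

theorem mono {m n : ℕ} {U : Op Λ} (h : Implementable m U) (hmn : m ≤ n) : Implementable n U := by
  obtain ⟨g, hg, hc⟩ := h
  exact ⟨g, hg, hc.trans hmn⟩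

theorem mul {m n : ℕ} {U V : Op Λ} (hU : Implementable m U) (hV : Implementable n V) :
    Implementable (m + n) (U * V) := by
  obtain ⟨g, rfl, hg⟩ := hU
  obtain ⟨h, rfl, hh⟩ := hV
  refine ⟨g ++ h, by simp [circuitOp], ?_⟩
  simpa [circuitCost] using add_le_add hg hh

theorem pow {n : ℕ} {U : Op Λ} (hU : Implementable n U) (r : ℕ) :
    Implementable (r * n) (U ^ r) := by
  induction r with
  | zero => simpa using one
  | succ r ih => rw [pow_succ, add_mul, one_mul]; exact ih.mul hU

theorem of_gate (γ : Gate) : Implementable γ.cost (γ.toOp Λ) :=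
  ⟨[γ], by simp [circuitOp], by simp [circuitCost]⟩

end Implementable

theorem onQubit_mul (u v : Matrix (Fin 2) (Fin 2) ℂ) :
    onQubit Λ (u * v) = onQubit Λ u * onQubit Λ v := by
  simp only [onQubit, fromBlocks_multiply, Matrix.mul_apply, Fin.sum_univ_two,
    mul_smul_comm, mul_one, add_smul, smul_smul, mul_comm]

theorem onQubit_one : onQubit Λ 1 = 1 := by
  simp [onQubit]

theorem onQubit_conjTranspose (u : Matrix (Fin 2) (Fin 2) ℂ) :
    star (onQubit Λ u) = onQubit Λ uᴴ := by
  simp [onQubit, star_eq_conjTranspose, fromBlocks_conjTranspose]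

theorem onQubit_mem_unitary {u : Matrix (Fin 2) (Fin 2) ℂ} (h₁ : uᴴ * u = 1) (h₂ : u * uᴴ = 1) :
    onQubit Λ u ∈ unitary (Op Λ) := by
  rw [Unitary.mem_iff, onQubit_conjTranspose, ← onQubit_mul, ← onQubit_mul, h₁, h₂]
  exact ⟨onQubit_one, onQubit_one⟩

/-- The skew-adjoint generator of `S₁`. -/
noncomputable def sOneGenerator (Λ : ℕ) : Op Λ :=
  fromBlocks 0 (Complex.I • creat Λ) (Complex.I • annih Λ) 0

theorem sOne_eq (τ : ℝ) : sOne Λ τ = exp ((τ : ℂ) • sOneGenerator Λ) := by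
  simp [sOne, sOneGenerator, fromBlocks_smul, smul_smul, mul_comm]

theorem exp_smul_mem_unitary {X : Op Λ} (hX : star X = -X) (τ : ℝ) :
    exp ((τ : ℂ) • X) ∈ unitary (Op Λ) := by
  let _ := NormedAlgebra.restrictScalars ℚ ℂ (Op Λ)
  refine exp_mem_unitary_of_mem_skewAdjoint ?_
  rw [skewAdjoint.mem_iff, star_smul, hX]
  simp

theorem star_sOneGenerator : star (sOneGenerator Λ) = -sOneGenerator Λ := by
  simp [sOneGenerator, star_eq_conjTranspose, fromBlocks_conjTranspose, creat, fromBlocks_neg]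

theorem gate_mem_unitary (γ : Gate) : γ.toOp Λ ∈ unitary (Op Λ) := by
  have hs : ((√2 : ℝ) : ℂ)⁻¹ * ((√2 : ℝ) : ℂ)⁻¹ = 1 / 2 := by
    rw [← mul_inv, ← Complex.ofReal_mul, Real.mul_self_sqrt (by norm_num)]; norm_num
  cases γ with
  | entangle τ hτ => rw [Gate.toOp, sOne_eq]; exact exp_smul_mem_unitary star_sOneGenerator τ
  | pauliX =>
    apply onQubit_mem_unitary <;> ext i j <;> fin_cases i <;> fin_cases j <;>
      simp [Matrix.mul_apply]
  | hadamard =>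
    apply onQubit_mem_unitary <;> ext i j <;> fin_cases i <;> fin_cases j <;>
      simp [Matrix.mul_apply, hs] <;> norm_num
  | phase =>
    apply onQubit_mem_unitary <;> ext i j <;> fin_cases i <;> fin_cases j <;>
      simp [Matrix.mul_apply]
  | phaseDagger =>
    apply onQubit_mem_unitary <;> ext i j <;> fin_cases i <;> fin_cases j <;>
      simp [Matrix.mul_apply]

theorem circuitOp_mem_unitary (g : List Gate) : circuitOp Λ g ∈ unitary (Op Λ) := by
  refine Submonoid.list_prod_mem _ fun U hU => ?_
  obtain ⟨γ, -, rfl⟩ := List.mem_map.1 hU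
  exact gate_mem_unitary γ

theorem Implementable.norm_eq_one {n : ℕ} {U : Op Λ} (h : Implementable n U) : ‖U‖ = 1 := by
  obtain ⟨g, rfl, -⟩ := h
  exact CStarRing.norm_of_mem_unitary (circuitOp_mem_unitary g)

/-- Generators whose flow, for any real time, takes at most one entangling gate. -/
def letters (Λ : ℕ) : Set (Op Λ) :=
  {X | (∀ τ : ℝ, Implementable 1 (exp ((τ : ℂ) • X))) ∧ ‖X‖ ≤ 2 * Λ}

theorem conj_mem_letters {X : Op Λ} (hX : X ∈ letters Λ) (u : (Op Λ)ˣ)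
    (hu : Implementable 0 (u : Op Λ)) (hu' : Implementable 0 ((u⁻¹ : (Op Λ)ˣ) : Op Λ)) :
    (u : Op Λ) * X * (u⁻¹ : (Op Λ)ˣ) ∈ letters Λ := by
  let _ := NormedAlgebra.restrictScalars ℚ ℂ (Op Λ)
  refine ⟨fun τ => ?_, ?_⟩
  · rw [← smul_mul_assoc, ← mul_smul_comm, NormedSpace.exp_units_conj]
    exact (hu.mul (hX.1 τ)).mul hu'
  · refine (norm_mul_le _ _).trans ?_
    rw [hu'.norm_eq_one, mul_one]
    refine (norm_mul_le _ _).trans ?_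
    rw [hu.norm_eq_one, one_mul]
    exact hX.2

theorem HasLetters.implementable {Γ : ℝ} {w : List (Op Λ)} (hw : HasLetters (letters Λ) Γ w)
    (s : ℝ) : Implementable w.length (evalWord w s) := by
  induction w with
  | nil => simpa [evalWord] using Implementable.one
  | cons X w ih =>
    obtain ⟨c, -, Y, hY, rfl⟩ := hw X (by simp)
    have h1 := (hY.1 (s * c)).mul (ih fun Z hZ => hw Z (by simp [hZ]))
    have h2 : evalWord ((c : ℂ) • Y :: w) s = exp (((s * c : ℝ) : ℂ) • Y) * evalWord w s := by
      simp [evalWord, mul_smul]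
    rw [h2, List.length_cons, add_comm]
    exact h1

/-! ### Diagonal operators in the Fock basis and the size of the generator -/

theorem creat_mul_diagonal_mul_annih (f : Fin (Λ + 1) → ℂ) :
    creat Λ * diagonal f * annih Λ =
      diagonal fun n : Fin (Λ + 1) => ∑ k : Fin (Λ + 1), if (k : ℕ) + 1 = n then (n : ℂ) * f k else 0 := by
  ext m n
  rw [mul_apply, diagonal_apply]
  simp only [creat, annih, mul_diagonal, conjTranspose_apply, of_apply]
  by_cases h : m = n
  · subst h
    simp only [if_true]
    refine Finset.sum_congr rfl fun k _ => ?_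
    split_ifs with hk
    · have : ((√(m : ℝ) : ℝ) : ℂ) * ((√(m : ℝ) : ℝ) : ℂ) = (m : ℕ) := by
        rw [← Complex.ofReal_mul, Real.mul_self_sqrt (by positivity)]; simp
      simp only [RCLike.star_def, Complex.conj_ofReal]
      rw [← this]; ring
    · simp
  · rw [if_neg h]
    refine Finset.sum_eq_zero fun k _ => ?_
    have : ¬ ((k : ℕ) + 1 = m ∧ (k : ℕ) + 1 = n) := fun hk => h (Fin.ext (by omega))
    by_cases h1 : (k : ℕ) + 1 = m
    · have h2 : ¬ (k : ℕ) + 1 = n := fun h2 => this ⟨h1, h2⟩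
      simp [h2]
    · simp [h1]

theorem annih_mul_diagonal_mul_creat (f : Fin (Λ + 1) → ℂ) :
    annih Λ * diagonal f * creat Λ =
      diagonal fun m : Fin (Λ + 1) => ∑ k : Fin (Λ + 1), if (m : ℕ) + 1 = k then (k : ℂ) * f k else 0 := by
  ext m n
  rw [mul_apply, diagonal_apply]
  simp only [creat, annih, mul_diagonal, conjTranspose_apply, of_apply]
  by_cases h : m = n
  · subst h
    simp only [if_true]
    refine Finset.sum_congr rfl fun k _ => ?_
    split_ifs with hk
    · have : ((√(k : ℝ) : ℝ) : ℂ) * ((√(k : ℝ) : ℝ) : ℂ) = (k : ℕ) := by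
        rw [← Complex.ofReal_mul, Real.mul_self_sqrt (by positivity)]; simp
      simp only [RCLike.star_def, Complex.conj_ofReal]
      rw [← this]; ring
    · simp
  · rw [if_neg h]
    refine Finset.sum_eq_zero fun k _ => ?_
    have : ¬ ((m : ℕ) + 1 = k ∧ (n : ℕ) + 1 = k) := fun hk => h (Fin.ext (by omega))
    by_cases h1 : (m : ℕ) + 1 = k
    · have h2 : ¬ (n : ℕ) + 1 = k := fun h2 => this ⟨h1, h2⟩
      simp [h2]
    · simp [h1]

theorem creat_mul_annih :
    creat Λ * annih Λ =
      diagonal fun n : Fin (Λ + 1) => ∑ k : Fin (Λ + 1), if (k : ℕ) + 1 = n then (n : ℂ) else 0 := by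
  have := creat_mul_diagonal_mul_annih (Λ := Λ) fun _ => 1
  simpa using this

theorem annih_mul_creat :
    annih Λ * creat Λ =
      diagonal fun m : Fin (Λ + 1) => ∑ k : Fin (Λ + 1), if (m : ℕ) + 1 = k then (k : ℂ) else 0 := by
  have := annih_mul_diagonal_mul_creat (Λ := Λ) fun _ => 1
  simpa using this

/-- By the C*-identity it suffices to bound a diagonal matrix. Each entry is crudely a sum of `Λ +
1` terms of size at most `Λ`; this loss is affordable because the rate contains `Λ⁴`. -/
theorem norm_sOneGenerator_le (hΛ : 1 ≤ Λ) : ‖sOneGenerator Λ‖ ≤ 2 * Λ := by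
  have h1 : star (sOneGenerator Λ) * sOneGenerator Λ = diagonal (Sum.elim
      (fun n : Fin (Λ + 1) => ∑ k : Fin (Λ + 1), if (k : ℕ) + 1 = n then (n : ℂ) else 0)
      (fun m : Fin (Λ + 1) => ∑ k : Fin (Λ + 1), if (m : ℕ) + 1 = k then (k : ℂ) else 0)) := by
    rw [star_sOneGenerator, ← fromBlocks_diagonal, ← creat_mul_annih, ← annih_mul_creat]
    simp [sOneGenerator, fromBlocks_multiply, fromBlocks_neg, smul_smul]
  have hΛ' : (1 : ℝ) ≤ Λ := by exact_mod_cast hΛ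
  have hsum (b : Fin (Λ + 1) → ℂ) (hb : ∀ k, ‖b k‖ ≤ Λ) : ‖∑ k, b k‖ ≤ (2 * Λ) * (2 * Λ) := by
    calc ‖∑ k, b k‖ ≤ ∑ _k : Fin (Λ + 1), (Λ : ℝ) := norm_sum_le_of_le _ fun k _ => hb k
      _ = (Λ + 1) * Λ := by simp
      _ ≤ _ := by nlinarith
  have hcoe (n : Fin (Λ + 1)) (p : Prop) [Decidable p] : ‖if p then (n : ℂ) else 0‖ ≤ Λ := by
    split_ifs
    · rw [Complex.norm_natCast]; exact_mod_cast Nat.lt_succ_iff.1 n.2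
    · simp
  have h2 : ‖sOneGenerator Λ‖ * ‖sOneGenerator Λ‖ ≤ (2 * Λ) * (2 * Λ) := by
    rw [← CStarRing.norm_star_mul_self, h1, l2_opNorm_diagonal]
    refine (pi_norm_le_iff_of_nonneg (by positivity)).2 ?_
    rintro (n | m)
    · exact hsum _ fun k => hcoe n _
    · exact hsum _ fun k => hcoe k _
  exact abs_le_of_sq_le_sq' (by nlinarith) (by positivity) |>.2

/-! ### Conjugation by single-qubit gates -/

/-- The Pauli gate, as a unit. -/
noncomputable def unitX (Λ : ℕ) : (Op Λ)ˣ where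
  val := Gate.toOp Λ .pauliX
  inv := Gate.toOp Λ .pauliX
  val_inv := by simp [Gate.toOp, ← onQubit_mul, ← onQubit_one, ← one_fin_two]
  inv_val := by simp [Gate.toOp, ← onQubit_mul, ← onQubit_one, ← one_fin_two]

/-- The phase gate, as a unit. -/
noncomputable def unitS (Λ : ℕ) : (Op Λ)ˣ where
  val := Gate.toOp Λ .phase
  inv := Gate.toOp Λ .phaseDagger
  val_inv := by simp [Gate.toOp, ← onQubit_mul, ← onQubit_one, ← one_fin_two]
  inv_val := by simp [Gate.toOp, ← onQubit_mul, ← onQubit_one, ← one_fin_two]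

theorem hadamard_mul_self : Gate.toOp Λ .hadamard * Gate.toOp Λ .hadamard = 1 := by
  have hs : ((√2 : ℝ) : ℂ)⁻¹ * ((√2 : ℝ) : ℂ)⁻¹ = 1 / 2 := by
    rw [← mul_inv, ← Complex.ofReal_mul, Real.mul_self_sqrt (by norm_num)]; norm_num
  rw [Gate.toOp, ← onQubit_mul, ← onQubit_one]
  congr 1
  ext i j
  fin_cases i <;> fin_cases j <;> simp [Matrix.mul_apply, hs] <;> norm_num

/-- The Hadamard gate, as a unit. -/
noncomputable def unitHad (Λ : ℕ) : (Op Λ)ˣ where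
  val := Gate.toOp Λ .hadamard
  inv := Gate.toOp Λ .hadamard
  val_inv := hadamard_mul_self
  inv_val := hadamard_mul_self

theorem unitX_conj_mem_letters {X : Op Λ} (hX : X ∈ letters Λ) :
    (unitX Λ : Op Λ) * X * ((unitX Λ)⁻¹ : (Op Λ)ˣ) ∈ letters Λ :=
  conj_mem_letters hX _ (.of_gate .pauliX) (.of_gate .pauliX)

theorem unitS_conj_mem_letters {X : Op Λ} (hX : X ∈ letters Λ) :
    (unitS Λ : Op Λ) * X * ((unitS Λ)⁻¹ : (Op Λ)ˣ) ∈ letters Λ :=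
  conj_mem_letters hX _ (.of_gate .phase) (.of_gate .phaseDagger)

theorem unitHad_conj_mem_letters {X : Op Λ} (hX : X ∈ letters Λ) :
    (unitHad Λ : Op Λ) * X * ((unitHad Λ)⁻¹ : (Op Λ)ˣ) ∈ letters Λ :=
  conj_mem_letters hX _ (.of_gate .hadamard) (.of_gate .hadamard)

variable (P Q R T : Matrix (Fin (Λ + 1)) (Fin (Λ + 1)) ℂ)

theorem unitX_conj : (unitX Λ : Op Λ) * fromBlocks P Q R T * ((unitX Λ)⁻¹ : (Op Λ)ˣ) =
    fromBlocks T R Q P := by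
  change Gate.toOp Λ .pauliX * _ * Gate.toOp Λ .pauliX = _
  simp [Gate.toOp, onQubit, fromBlocks_multiply]

theorem unitS_conj : (unitS Λ : Op Λ) * fromBlocks P Q R T * ((unitS Λ)⁻¹ : (Op Λ)ˣ) =
    fromBlocks P (-Complex.I • Q) (Complex.I • R) T := by
  change Gate.toOp Λ .phase * _ * Gate.toOp Λ .phaseDagger = _
  simp [Gate.toOp, onQubit, fromBlocks_multiply, smul_smul]

theorem unitHad_conj :
    (unitHad Λ : Op Λ) * fromBlocks 0 P P 0 * ((unitHad Λ)⁻¹ : (Op Λ)ˣ) = fromBlocks P 0 0 (-P) := by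
  have hs : ((√2 : ℝ) : ℂ)⁻¹ * ((√2 : ℝ) : ℂ)⁻¹ = 1 / 2 := by
    rw [← mul_inv, ← Complex.ofReal_mul, Real.mul_self_sqrt (by norm_num)]; norm_num
  change Gate.toOp Λ .hadamard * _ * Gate.toOp Λ .hadamard = _
  simp [Gate.toOp, onQubit, fromBlocks_multiply, smul_smul, hs, ← add_smul]
  constructor <;> module

theorem sOneGenerator_mem_letters (hΛ : 1 ≤ Λ) : sOneGenerator Λ ∈ letters Λ := by
  let _ := NormedAlgebra.restrictScalars ℚ ℂ (Op Λ)
  have hpos (τ : ℝ) (hτ : 0 < τ) : Implementable 1 (exp ((τ : ℂ) • sOneGenerator Λ)) := by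
    rw [← sOne_eq]; exact .of_gate (.entangle τ hτ)
  refine ⟨fun τ => ?_, norm_sOneGenerator_le hΛ⟩
  rcases lt_trichotomy τ 0 with h | rfl | h
  -- `S² = Z` flips the sign of the off-diagonal blocks, so conjugating by it reverses time at no
  -- cost.
  · let u := unitS Λ * unitS Λ
    have hu : (u : Op Λ) * sOneGenerator Λ * (u⁻¹ : (Op Λ)ˣ) = -sOneGenerator Λ := by
      have h1 : (u : Op Λ) * sOneGenerator Λ * (u⁻¹ : (Op Λ)ˣ) = unitS Λ *
          (unitS Λ * sOneGenerator Λ * ((unitS Λ)⁻¹ : (Op Λ)ˣ)) * ((unitS Λ)⁻¹ : (Op Λ)ˣ) := by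
        simp [u, mul_assoc]
      rw [h1, sOneGenerator, unitS_conj, unitS_conj]
      simp [smul_smul, fromBlocks_neg]
    have h2 : (τ : ℂ) • sOneGenerator Λ
        = u * (((-τ : ℝ) : ℂ) • sOneGenerator Λ) * (u⁻¹ : (Op Λ)ˣ) := by
      rw [mul_smul_comm, smul_mul_assoc, hu]; simp
    rw [h2, NormedSpace.exp_units_conj]
    have hS : Implementable 0 (u : Op Λ) := (Implementable.of_gate .phase).mul (.of_gate .phase)
    have hS' : Implementable 0 ((u⁻¹ : (Op Λ)ˣ) : Op Λ) := by
      rw [_root_.mul_inv_rev, Units.val_mul]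
      exact (Implementable.of_gate .phaseDagger).mul (.of_gate .phaseDagger)
    exact (hS.mul (hpos (-τ) (by linarith))).mul hS'
  · simpa using Implementable.one.mono zero_le_one
  · exact hpos τ h

/-! ### Generating the quadratic and quartic terms -/

/-- The block-diagonal operator `diag (a† a, -a a†)`. -/
noncomputable def quadraticTerm (Λ : ℕ) : Op Λ :=
  fromBlocks (creat Λ * annih Λ) 0 0 (-(annih Λ * creat Λ))

/-- The block-diagonal operator `diag ((a†)² a², -a² (a†)²)`. -/
noncomputable def quarticTerm (Λ : ℕ) : Op Λ :=
  fromBlocks (creat Λ ^ 2 * annih Λ ^ 2) 0 0 (-(annih Λ ^ 2 * creat Λ ^ 2))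

theorem generates_quadraticTerm (hΛ : 1 ≤ Λ) :
    Generates (letters Λ) 2 4 ((2 * Complex.I) • quadraticTerm Λ) := by
  have h1 := sOneGenerator_mem_letters hΛ
  have h := ((Generates.of_mem h1).commutator (.of_mem (unitS_conj_mem_letters h1))).neg
  convert h using 1
  rw [sOneGenerator, unitS_conj]
  simp only [fromBlocks_multiply, smul_smul, quadraticTerm, fromBlocks_smul, neg_mul,
    Complex.I_mul_I, neg_neg, one_smul, neg_smul, mul_neg, smul_mul_assoc, mul_smul_comm, mul_zero,
    zero_mul, zero_add, add_zero, smul_zero, sub_eq_add_neg, fromBlocks_neg, fromBlocks_add,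
    neg_zero, neg_add, smul_neg, two_mul, add_smul]

/-- Put `G = a† + a` and `J = a - a†`. The commutators of the `Y`- and `Z`-type letters give
multiples of `G² + J² = 2(a² + a†²)`, in which the mixed products cancel. The commutator of `Z ⊗ iG`
with `X ⊗ J` gives `GJ + JG = 2(a² - a†²)` with opposite signs in the two blocks. Adding it twice
leaves only `a†²` above and `a²` below. -/
theorem generates_quadratic_raising (hΛ : 1 ≤ Λ) :
    Generates (letters Λ) 2 32 (fromBlocks 0 ((-8 * Complex.I) • creat Λ ^ 2)
      ((-8 * Complex.I) • annih Λ ^ 2) 0) := by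
  set A := annih Λ with hA
  set C := creat Λ with hC
  have h1 := sOneGenerator_mem_letters hΛ
  have h2 := unitX_conj_mem_letters h1
  have h3 := unitS_conj_mem_letters h1
  have h4 := unitX_conj_mem_letters h3
  rw [sOneGenerator, unitX_conj] at h2
  rw [sOneGenerator, unitS_conj, unitX_conj] at h4
  rw [sOneGenerator, unitS_conj] at h3
  rw [sOneGenerator] at h1
  simp only [smul_smul, neg_mul, Complex.I_mul_I, neg_neg, one_smul, neg_smul] at h3 h4
  rw [← hA, ← hC] at h1 h2 h3 h4
  have xG : Generates (letters Λ) 1 2 (fromBlocks 0 (Complex.I • (C + A))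
      (Complex.I • (C + A)) 0) := by
    convert (Generates.of_mem h1).add (.of_mem h2) using 1
    simp [fromBlocks_add, add_comm]
  have yG : Generates (letters Λ) 1 2 (fromBlocks 0 (C + A) (-(C + A)) 0) := by
    convert (Generates.of_mem h3).sub (.of_mem h4) using 1
    simp [fromBlocks_add, fromBlocks_neg, sub_eq_add_neg, add_comm]
  have xJ : Generates (letters Λ) 1 2 (fromBlocks 0 (A - C) (A - C) 0) := by
    convert ((Generates.of_mem h3).add (.of_mem h4)).neg using 1
    simp [fromBlocks_add, fromBlocks_neg, sub_eq_add_neg, add_comm]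
  have yJ : Generates (letters Λ) 1 2 (fromBlocks 0 (Complex.I • (C - A))
      (Complex.I • (A - C)) 0) := by
    convert (Generates.of_mem h1).sub (.of_mem h2) using 1
    simp [fromBlocks_add, fromBlocks_neg, sub_eq_add_neg]
  have zG := xG.conj (unitHad Λ) fun _ => unitHad_conj_mem_letters
  have zJ := xJ.conj (unitHad Λ) fun _ => unitHad_conj_mem_letters
  rw [unitHad_conj] at zG zJ
  have t3 := zG.commutator xJ
  have h := ((yG.commutator zG).sub (yJ.commutator zJ)).add (t3.add t3)
  convert h using 1
  simp only [fromBlocks_multiply, sub_eq_add_neg, fromBlocks_neg, fromBlocks_add, mul_zero,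
    zero_mul, zero_add, add_zero, neg_zero]
  congr 1
  all_goals
    simp only [add_mul, mul_add, smul_add, smul_mul_assoc, mul_smul_comm, smul_neg, neg_mul,
      mul_neg, pow_two]
    module

/-- The same commutator with a phase conjugate as for the quadratic term, with `a²` in the role of
`a`. -/
theorem generates_quarticTerm (hΛ : 1 ≤ Λ) :
    Generates (letters Λ) 4 128 ((128 * Complex.I) • quarticTerm Λ) := by
  have h1 := generates_quadratic_raising hΛ
  have h2 := h1.conj (unitS Λ) fun _ => unitS_conj_mem_letters
  have h := (h1.commutator h2).neg
  convert h using 1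
  rw [unitS_conj]
  simp only [fromBlocks_multiply, sub_eq_add_neg, fromBlocks_neg, fromBlocks_add, mul_zero,
    zero_mul, zero_add, add_zero, neg_zero, quarticTerm, fromBlocks_smul, smul_zero, smul_mul_assoc,
    mul_smul_comm, smul_smul]
  congr 1
  · rw [← neg_smul, ← add_smul, ← neg_smul]
    congr 1
    linear_combination (128 * Complex.I) * Complex.I_mul_I
  · rw [smul_neg, ← neg_smul, ← neg_smul, ← add_smul, ← neg_smul]
    congr 1
    linear_combination (-128 * Complex.I) * Complex.I_mul_I

/-- Both are diagonal: sandwiching a diagonal matrix between a creation and an annihilation matrix,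
in either order, gives a diagonal matrix again. Splitting the evolution into the two terms therefore
costs no error. -/
theorem commute_quadraticTerm_quarticTerm : Commute (quadraticTerm Λ) (quarticTerm Λ) := by
  have h1 : ∃ f, quadraticTerm Λ = diagonal f := by
    rw [quadraticTerm, creat_mul_annih, annih_mul_creat, diagonal_neg, fromBlocks_diagonal]
    exact ⟨_, rfl⟩
  have h2 : ∃ f, quarticTerm Λ = diagonal f := by
    have h3 : creat Λ ^ 2 * annih Λ ^ 2 = creat Λ * (creat Λ * annih Λ) * annih Λ := by
      simp only [pow_two, mul_assoc]
    have h4 : annih Λ ^ 2 * creat Λ ^ 2 = annih Λ * (annih Λ * creat Λ) * creat Λ := by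
      simp only [pow_two, mul_assoc]
    rw [quarticTerm, h3, h4, creat_mul_annih, annih_mul_creat, creat_mul_diagonal_mul_annih,
      annih_mul_diagonal_mul_creat, diagonal_neg, fromBlocks_diagonal]
    exact ⟨_, rfl⟩
  obtain ⟨f, hf⟩ := h1
  obtain ⟨g, hg⟩ := h2
  rw [hf, hg]
  exact commute_diagonal f g

theorem star_I_smul_quadraticTerm :
    star (Complex.I • quadraticTerm Λ) = -(Complex.I • quadraticTerm Λ) := by
  simp [quadraticTerm, star_eq_conjTranspose, fromBlocks_conjTranspose, creat]

theorem star_I_smul_quarticTerm :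
    star (Complex.I • quarticTerm Λ) = -(Complex.I • quarticTerm Λ) := by
  simp [quarticTerm, star_eq_conjTranspose, fromBlocks_conjTranspose, creat]

theorem blockEvolution_eq (ω κ t : ℝ) :
    blockEvolution Λ ω κ t = exp (((t * ω : ℝ) : ℂ) • (Complex.I • quadraticTerm Λ)
      + ((t * (κ / 2) : ℝ) : ℂ) • (Complex.I • quarticTerm Λ)) := by
  rw [blockEvolution]
  congr 1
  simp only [hamiltonian, lowerBlock, quadraticTerm, quarticTerm, fromBlocks_smul, fromBlocks_add,
    smul_zero, add_zero]
  push_cast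
  congr 1 <;> module

end Circuits

/-! ### Segments and the total error -/

section Simulation

open NormedSpace Matrix
open scoped Matrix.Norms.L2Operator

theorem norm_mul_sub_mul_le {𝔸 : Type*} [NormedRing 𝔸] {a b c d : 𝔸} (hb : ‖b‖ ≤ 1)
    (hc : ‖c‖ ≤ 1) : ‖a * b - c * d‖ ≤ ‖a - c‖ + ‖b - d‖ := by
  have h : a * b - c * d = (a - c) * b + c * (b - d) := by noncomm_ring
  rw [h]
  refine (norm_add_le _ _).trans (add_le_add ?_ ?_)
  · exact (norm_mul_le _ _).trans (mul_le_of_le_one_right (norm_nonneg _) hb)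
  · exact (norm_mul_le _ _).trans (mul_le_of_le_one_left (norm_nonneg _) hc)

theorem norm_pow_sub_pow_le_mul {𝔸 : Type*} [NormedRing 𝔸] [NormOneClass 𝔸] {a b : 𝔸}
    (ha : ‖a‖ ≤ 1) (hb : ‖b‖ ≤ 1) (n : ℕ) : ‖a ^ n - b ^ n‖ ≤ n * ‖a - b‖ := by
  induction n with
  | zero => simp
  | succ n ih =>
    rw [pow_succ, pow_succ]
    refine (norm_mul_sub_mul_le ha
      ((norm_pow_le b n).trans (pow_le_one₀ (norm_nonneg _) hb))).trans ?_
    push_cast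
    linarith

/-- The product formula is used with `j = k (q - 1)`, so its error has order `kq + 1` in `s`, where
`s ^ k` is proportional to `|x|`. In terms of `y` this is `q + 1/k`, at least `q + 1/4` for `k ≤ 4`.
-/
theorem exists_segment {k : ℕ} (hk : k ≠ 0) (hk4 : k ≤ 4) (N : ℕ) :
    ∃ K : ℕ, 1 ≤ K ∧ ∀ Λ, 1 ≤ Λ → ∀ (D : Op Λ) (b : ℝ), 1 ≤ b →
      Generates (letters Λ) k N ((b : ℂ) • (Complex.I • D)) → ∀ q, 1 ≤ q → ∀ x y : ℝ,
        ((K : ℝ) ^ (k * q) * (2 * Λ)) ^ k * |x| ≤ y → y ≤ 1 →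
          ∃ U : Op Λ, Implementable (K ^ (k * q)) U ∧
            ‖U - exp ((x : ℂ) • (Complex.I • D))‖ ≤ K * y ^ ((q : ℝ) + 1 / 4) := by
  obtain ⟨K, hK, h⟩ := exists_product_formula hk N
  refine ⟨K, hK, fun Λ hΛ D b hb hD q hq x y hxy hy => ?_⟩
  have hK' : (1 : ℝ) ≤ K := by exact_mod_cast hK
  have hΛ' : (1 : ℝ) ≤ Λ := by exact_mod_cast hΛ
  have hk0 : (0 : ℝ) < k := by exact_mod_cast Nat.pos_of_ne_zero hk
  have hy0 : 0 ≤ y := le_trans (by positivity) hxy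
  have hj : k * (q - 1) + 1 ≤ k * q := by
    obtain ⟨p, rfl⟩ := Nat.exists_eq_add_of_le' hq
    rw [Nat.add_sub_cancel, Nat.mul_succ]
    omega
  have hj' : k + 1 + k * (q - 1) = k * q + 1 := by
    obtain ⟨p, rfl⟩ := Nat.exists_eq_add_of_le' hq
    rw [Nat.add_sub_cancel, Nat.mul_succ]
    omega
  set s : ℝ := (|x| / b) ^ (1 / (k : ℝ)) with hs
  have hs0 : 0 ≤ s := by positivity
  have hsk : s ^ k = |x| / b := by
    rw [hs, ← Real.rpow_natCast, ← Real.rpow_mul (by positivity), one_div_mul_cancel hk0.ne',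
      Real.rpow_one]
  have hb0 : (b : ℂ) ≠ 0 := by exact_mod_cast (by linarith : b ≠ 0)
  -- Since `s ≥ 0`, the sign of `x` has to be carried by the generated element.
  obtain ⟨B, hB, hBx⟩ : ∃ B, Generates (letters Λ) k N B ∧
      (s : ℂ) ^ k • B = (x : ℂ) • (Complex.I • D) := by
    have hsk' : (s : ℂ) ^ k = (|x| : ℝ) / (b : ℂ) := by
      rw [← Complex.ofReal_pow, hsk]; simp
    rcases le_total 0 x with h0 | h0
    · refine ⟨_, hD, ?_⟩
      rw [hsk', abs_of_nonneg h0, smul_smul, div_mul_cancel₀ _ hb0]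
    · refine ⟨_, hD.neg, ?_⟩
      rw [hsk', abs_of_nonpos h0, smul_neg, smul_smul, div_mul_cancel₀ _ hb0]
      simp
  obtain ⟨w, Γ, hw, hlen, hsw⟩ := h (Op Λ) (letters Λ) (2 * Λ) B (by positivity)
    (fun Y hY => hY.2) hB (k * (q - 1))
  set u : ℝ := K ^ (k * (q - 1) + 1) * (2 * Λ) * s with hu
  have hu0 : 0 ≤ u := by positivity
  have huk : u ^ k ≤ y := by
    refine le_trans ?_ hxy
    rw [hu, mul_pow, hsk]
    gcongr
    exact div_le_self (abs_nonneg _) hb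
  have hu1 : u ≤ 1 := (pow_le_one_iff_of_nonneg hu0 hk).1 (huk.trans hy)
  refine ⟨evalWord w s, (hw.implementable s).mono (hlen.trans (Nat.pow_le_pow_right hK hj)), ?_⟩
  have h1 := hsw s hs0 hu1
  rw [hBx, hj', ← hu] at h1
  refine h1.trans (mul_le_mul_of_nonneg_left ?_ (by positivity))
  rcases hy0.eq_or_lt with h0 | h0
  · have : u = 0 := pow_eq_zero_iff hk |>.1 (le_antisymm (h0 ▸ huk) (by positivity))
    rw [this, zero_pow (by omega)]
    positivity
  · calc u ^ (k * q + 1) ≤ (y ^ (1 / (k : ℝ))) ^ (k * q + 1) := by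
          refine pow_le_pow_left₀ hu0 ?_ _
          rw [one_div, Real.le_rpow_inv_iff_of_pos hu0 hy0 hk0, Real.rpow_natCast]
          exact huk
      _ = y ^ ((q : ℝ) + 1 / k) := by
          rw [← Real.rpow_natCast, ← Real.rpow_mul hy0]
          congr 1
          push_cast
          field_simp
      _ ≤ y ^ ((q : ℝ) + 1 / 4) := by
          refine Real.rpow_le_rpow_of_exponent_ge h0 hy ?_
          gcongr
          exact_mod_cast hk4

theorem exp_smul_I_smul_norm {Λ : ℕ} {D : Op Λ}
    (hD : star (Complex.I • D) = -(Complex.I • D)) (x : ℝ) :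
    ‖exp ((x : ℂ) • (Complex.I • D))‖ = 1 :=
  CStarRing.norm_of_mem_unitary (exp_smul_mem_unitary hD x)

theorem blockEvolution_eq_pow {Λ : ℕ} (ω κ t : ℝ) {R : ℕ} (hR : R ≠ 0) :
    blockEvolution Λ ω κ t = (exp (((t * ω / R : ℝ) : ℂ) • (Complex.I • quadraticTerm Λ))
      * exp (((t * (κ / 2) / R : ℝ) : ℂ) • (Complex.I • quarticTerm Λ))) ^ R := by
  let _ := NormedAlgebra.restrictScalars ℚ ℂ (Op Λ)
  have hcom (x y : ℂ) : Commute (x • (Complex.I • quadraticTerm Λ))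
      (y • (Complex.I • quarticTerm Λ)) :=
    (((commute_quadraticTerm_quarticTerm.smul_left _).smul_left _).smul_right _).smul_right _
  rw [← NormedSpace.exp_add_of_commute (hcom _ _), ← NormedSpace.exp_nsmul, blockEvolution_eq]
  have hR' : (R : ℂ) ≠ 0 := by exact_mod_cast hR
  rw [← Nat.cast_smul_eq_nsmul ℂ, smul_add, smul_smul (R : ℂ), smul_smul (R : ℂ)]
  push_cast
  rw [mul_div_cancel₀ _ hR', mul_div_cancel₀ _ hR']

theorem norm_blockEvolution {Λ : ℕ} (ω κ t : ℝ) : ‖blockEvolution Λ ω κ t‖ ≤ 1 := by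
  rw [blockEvolution_eq_pow ω κ t one_ne_zero, pow_one]
  refine (norm_mul_le _ _).trans ?_
  rw [exp_smul_I_smul_norm star_I_smul_quadraticTerm, exp_smul_I_smul_norm star_I_smul_quarticTerm,
    one_mul]

/-- The error of all segments together, for `R = r B ^ q` segments, `B = (2 K M ^ 2) ^ 4`. -/
theorem segment_count_bound {K M r : ℝ} {q : ℕ} (hq : 1 ≤ q) (hK : 1 ≤ K) (hM : 1 ≤ M)
    (hr : 0 < r) {X ε : ℝ} (hX : 0 ≤ X) (hε : 0 < ε)
    (h : X ^ (1 + 1 / ((q : ℝ) - 3 / 4)) / ε ^ (1 / ((q : ℝ) - 3 / 4)) ≤ r) :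
    r * ((2 * K * M ^ 2) ^ 4) ^ q *
      (2 * K * (M ^ q * X / (r * ((2 * K * M ^ 2) ^ 4) ^ q)) ^ ((q : ℝ) + 1 / 4)) ≤ ε := by
  have hq' : (1 : ℝ) ≤ q := by exact_mod_cast hq
  obtain ⟨p, hp⟩ : ∃ p : ℝ, p = (q : ℝ) - 3 / 4 := ⟨_, rfl⟩
  have hp0 : 0 < p := by linarith
  have hp1 : (q : ℝ) / 4 ≤ p := by linarith
  have hqp : (q : ℝ) + 1 / 4 = p + 1 := by linarith
  rw [← hp] at h
  rw [hqp]
  set W : ℝ := 2 * K * M ^ 2 with hW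
  have hM2 : 1 ≤ M ^ 2 := one_le_pow₀ hM
  have hW1 : 1 ≤ W := by nlinarith
  have hXp : X ^ (p + 1) ≤ r ^ p * ε := by
    rw [div_le_iff₀ (by positivity)] at h
    have h1 := Real.rpow_le_rpow (by positivity) h hp0.le
    rw [← Real.rpow_mul hX, Real.mul_rpow hr.le (by positivity), ← Real.rpow_mul hε.le,
      one_div_mul_cancel hp0.ne', Real.rpow_one, add_mul, one_mul, one_div_mul_cancel hp0.ne'] at h1
    exact h1
  set Q : ℝ := (W ^ 4) ^ q with hQ
  have hQ0 : 0 < Q := by positivity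
  -- The left side is at most `W ^ (q²)`, using `p + 1 ≤ 2q`. The fourth power in `Q` compensates
  -- for `p` being possibly as small as `q / 4`, attained at `q = 1`.
  have hMQ : 2 * K * (M ^ q) ^ (p + 1) ≤ Q ^ p := by
    calc 2 * K * (M ^ q) ^ (p + 1) ≤ (2 * K) ^ (q * q) * (M ^ q) ^ ((2 * q : ℕ) : ℝ) := by
          refine mul_le_mul (le_self_pow₀ (by linarith) (by positivity)) ?_ (by positivity)
            (by positivity)
          refine Real.rpow_le_rpow_of_exponent_le (one_le_pow₀ hM) ?_
          push_cast
          linarith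
      _ = W ^ (q * q) := by
          rw [Real.rpow_natCast, ← pow_mul, hW, mul_pow (2 * K), ← pow_mul]
          congr 2; ring
      _ = Q ^ ((q : ℝ) / 4) := by
          rw [hQ, ← pow_mul, ← Real.rpow_natCast W (4 * q), ← Real.rpow_mul (by positivity),
            ← Real.rpow_natCast]
          congr 1; push_cast; ring
      _ ≤ Q ^ p := Real.rpow_le_rpow_of_exponent_le (one_le_pow₀ (one_le_pow₀ hW1)) hp1
  have hR : 0 < r * Q := by positivity
  calc r * Q * (2 * K * (M ^ q * X / (r * Q)) ^ (p + 1))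
      = 2 * K * (M ^ q) ^ (p + 1) * X ^ (p + 1) / (r * Q) ^ p := by
        rw [Real.div_rpow (by positivity) hR.le, Real.mul_rpow (by positivity) hX,
          Real.rpow_add hR, Real.rpow_one]
        field_simp
    _ ≤ Q ^ p * (r ^ p * ε) / (r * Q) ^ p := by gcongr
    _ = ε := by
        rw [Real.mul_rpow hr.le hQ0.le]
        field_simp

theorem exists_circuit_of_segments {K₂ K₄ Λ R : ℕ}
    {ω κ t e : ℝ} (hR : R ≠ 0)
    {U₂ U₄ : Op Λ} (h₂ : Implementable K₂ U₂) (h₄ : Implementable K₄ U₄)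
    (e₂ : ‖U₂ - exp (((t * ω / R : ℝ) : ℂ) • (Complex.I • quadraticTerm Λ))‖ ≤ e)
    (e₄ : ‖U₄ - exp (((t * (κ / 2) / R : ℝ) : ℂ) • (Complex.I • quarticTerm Λ))‖ ≤ e) :
    ∃ g, circuitCost g ≤ R * (K₂ + K₄) ∧
      opNorm (circuitOp Λ g - blockEvolution Λ ω κ t) ≤ R * (2 * e) := by
  obtain ⟨g, hg, hc⟩ := (h₂.mul h₄).pow R
  refine ⟨g, hc, ?_⟩
  rw [hg, opNorm_eq_norm, blockEvolution_eq_pow ω κ t hR]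
  have h1 := exp_smul_I_smul_norm (star_I_smul_quadraticTerm (Λ := Λ)) (t * ω / R)
  have h2 := exp_smul_I_smul_norm (star_I_smul_quarticTerm (Λ := Λ)) (t * (κ / 2) / R)
  refine (norm_pow_sub_pow_le_mul (h₂.mul h₄).norm_eq_one.le ?_ R).trans ?_
  · refine (norm_mul_le _ _).trans ?_
    rw [h1, h2, one_mul]
  · refine mul_le_mul_of_nonneg_left ?_ (by positivity)
    refine (norm_mul_sub_mul_le h₄.norm_eq_one.le h1.le).trans ?_
    linarith

end Simulation

end HybridOscillator

/-! ### Choice of constants and assembly -/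

open HybridOscillator in
open scoped Matrix.Norms.L2Operator in
theorem mainTheorem6 :
    ∃ C c : ℝ, 0 < C ∧ 0 < c ∧
      ∀ (q : ℕ), 1 ≤ q → ∀ (Λ : ℕ), 1 ≤ Λ →
      ∀ (ω κ t ε : ℝ), 0 ≤ t → 0 < ε →
      ∀ (r : ℕ), C * HybridOscillator.stepRate q Λ ω κ t ε ≤ (r : ℝ) →
        ∃ g : List HybridOscillator.Gate,
          (HybridOscillator.circuitCost g : ℝ) ≤ (r : ℝ) * Real.exp (c * (q : ℝ)) ∧
          HybridOscillator.opNorm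
            (HybridOscillator.circuitOp Λ g - HybridOscillator.blockEvolution Λ ω κ t) ≤ ε := by
  obtain ⟨K₂, hK₂, H₂⟩ := exists_segment two_ne_zero (by norm_num) 4
  obtain ⟨K₄, hK₄, H₄⟩ := exists_segment four_ne_zero le_rfl 128
  obtain ⟨K, hK⟩ : ∃ K : ℕ, K = K₂ + K₄ := ⟨_, rfl⟩
  -- `M ^ q Λ⁴` dominates the scale factor `(K ^ (kq) 2Λ) ^ k` for `k = 2` and `k = 4`; the case `k
  -- = 4` dictates both 16s.
  obtain ⟨M, hM⟩ : ∃ M : ℕ, M = 16 * K ^ 16 := ⟨_, rfl⟩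
  obtain ⟨B, hB⟩ : ∃ B : ℕ, B = (2 * K * M ^ 2) ^ 4 := ⟨_, rfl⟩
  have hK1 : 1 ≤ K := by omega
  have hKr : (1 : ℝ) ≤ K := by exact_mod_cast hK1
  have hM1 : 1 ≤ M := by
    have : 0 < K ^ 16 := by positivity
    omega
  have hMr : (1 : ℝ) ≤ M := by exact_mod_cast hM1
  have hB1 : 1 ≤ B := by rw [hB]; exact Nat.one_le_iff_ne_zero.2 (by positivity)
  have hBr : (1 : ℝ) ≤ B := by exact_mod_cast hB1
  have hBK : (1 : ℝ) < 2 * B * K ^ 4 := by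
    have := one_le_pow₀ hKr (n := 4)
    nlinarith
  refine ⟨1, Real.log (2 * B * K ^ 4), one_pos, Real.log_pos hBK,
    fun q hq Λ hΛ ω κ t ε ht hε r hr => ?_⟩
  have hΛr : (1 : ℝ) ≤ Λ := by exact_mod_cast hΛ
  have hempty : circuitOp Λ [] = 1 := by simp [circuitOp]
  have hcost : ((circuitCost [] : ℕ) : ℝ) ≤ r * Real.exp (Real.log (2 * B * K ^ 4) * q) := by
    simp only [circuitCost, List.map_nil, List.sum_nil, Nat.cast_zero]
    positivity
  -- Two contractions differ by at most 2, so the empty circuit suffices. The remaining case `ε < 2`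
  -- is what forces `y ≤ 1` below.
  by_cases hε2 : 2 ≤ ε
  · refine ⟨[], hcost, ?_⟩
    rw [hempty, opNorm_eq_norm]
    refine (norm_sub_le _ _).trans ?_
    have h1 : ‖(1 : Op Λ)‖ = 1 := norm_one
    have := norm_blockEvolution (Λ := Λ) ω κ t
    linarith
  obtain ⟨X, hX⟩ : ∃ X : ℝ, X = (Λ : ℝ) ^ 4 * max |ω| |κ| * t := ⟨_, rfl⟩
  have hω0 : 0 ≤ max |ω| |κ| := (abs_nonneg ω).trans (le_max_left _ _)
  have hX0 : 0 ≤ X := by rw [hX]; positivity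
  rw [stepRate, ← hX, one_mul] at hr
  -- Here `r = 0` is possible, but the evolution is trivial; otherwise the rate is positive and `r ≥
  -- 1`.
  rcases hX0.eq_or_lt with h0 | hXpos
  · refine ⟨[], hcost, ?_⟩
    have h1 : max |ω| |κ| * t = 0 := by
      rw [hX, mul_assoc] at h0
      exact (mul_eq_zero.1 h0.symm).resolve_left (by positivity)
    have h2 : t * ω = 0 ∧ t * κ = 0 := by
      rcases mul_eq_zero.1 h1 with h | h
      · have h3 : |ω| ≤ 0 := h ▸ le_max_left _ _
        have h4 : |κ| ≤ 0 := h ▸ le_max_right _ _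
        simp [abs_nonpos_iff.1 h3, abs_nonpos_iff.1 h4]
      · simp [h]
    have h3 : blockEvolution Λ ω κ t = 1 := by
      rw [blockEvolution_eq, h2.1, show t * (κ / 2) = t * κ / 2 by ring, h2.2]
      simp
    rw [hempty, h3, sub_self, opNorm_eq_norm, norm_zero]
    exact hε.le
  have hrpos : (0 : ℝ) < r := lt_of_lt_of_le (by positivity) hr
  have hr1 : (1 : ℝ) ≤ r := by exact_mod_cast (Nat.cast_pos.1 hrpos : 0 < r)
  have hmain := segment_count_bound hq hKr hMr hrpos hX0 hε hr
  have hBr' : (B : ℝ) = (2 * K * M ^ 2) ^ 4 := by rw [hB]; push_cast; rfl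
  rw [← hBr'] at hmain
  obtain ⟨R, hR⟩ : ∃ R : ℕ, R = r * B ^ q := ⟨_, rfl⟩
  have hRr : (r : ℝ) * B ^ q = R := by rw [hR]; push_cast; rfl
  rw [hRr] at hmain
  have hR1 : (1 : ℝ) ≤ R := by
    rw [← hRr]; exact one_le_mul_of_one_le_of_one_le hr1 (one_le_pow₀ hBr)
  have hR0 : R ≠ 0 := by rintro rfl; norm_num at hR1
  obtain ⟨y, hy⟩ : ∃ y : ℝ, y = M ^ q * X / R := ⟨_, rfl⟩
  rw [← hy] at hmain
  -- If `y > 1`, the left side of `hmain` would be at least 2, contradicting `ε < 2`.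
  have hy1 : y ≤ 1 := by
    by_contra! hlt
    have h1 : 1 ≤ y ^ ((q : ℝ) + 1 / 4) := Real.one_le_rpow hlt.le (by positivity)
    have h2 : (1 : ℝ) ≤ R * (K * y ^ ((q : ℝ) + 1 / 4)) :=
      one_le_mul_of_one_le_of_one_le hR1 (one_le_mul_of_one_le_of_one_le hKr h1)
    nlinarith
  have hy0 : 0 ≤ y := by rw [hy]; positivity
  have hK₂K : (K₂ : ℝ) ≤ K := by rw [hK]; push_cast; linarith [K₄.cast_nonneg (α := ℝ)]
  have hK₄K : (K₄ : ℝ) ≤ K := by rw [hK]; push_cast; linarith [K₂.cast_nonneg (α := ℝ)]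
  have hMq : (M : ℝ) ^ q = 16 ^ q * K ^ (16 * q) := by
    rw [hM]; push_cast; rw [mul_pow, ← pow_mul]
  have h16 : (16 : ℝ) ≤ 16 ^ q := le_self_pow₀ (by norm_num) (by omega)
  have hscale (L : ℝ) (hL0 : 0 ≤ L) (hL : L ≤ 16 * K ^ (16 * q) * Λ ^ 4) (x : ℝ)
      (hx : |x| ≤ max |ω| |κ| * t) : L * |x / R| ≤ y := by
    have hR' : (0 : ℝ) < R := by linarith
    rw [abs_div, abs_of_pos hR', hy, ← mul_div_assoc]
    refine div_le_div_of_nonneg_right ?_ hR'.le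
    calc L * |x| ≤ (16 * K ^ (16 * q) * Λ ^ 4) * (max |ω| |κ| * t) := by gcongr
      _ ≤ (16 ^ q * K ^ (16 * q) * Λ ^ 4) * (max |ω| |κ| * t) := by gcongr
      _ = M ^ q * X := by rw [hMq, hX]; ring
  obtain ⟨U₂, hU₂, e₂⟩ := H₂ Λ hΛ (quadraticTerm Λ) 2 (by norm_num)
    (by simpa [smul_smul] using generates_quadraticTerm hΛ) q hq (t * ω / R) y
    (by
      refine hscale _ (by positivity) ?_ _ ?_
      · rw [mul_pow, ← pow_mul, show (2 * (Λ : ℝ)) ^ 2 = 4 * Λ ^ 2 by ring]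
        have h1 : (K₂ : ℝ) ^ (2 * q * 2) ≤ K ^ (16 * q) :=
          (pow_le_pow_left₀ (by positivity) hK₂K _).trans (pow_le_pow_right₀ hKr (by omega))
        have h2 : (Λ : ℝ) ^ 2 ≤ Λ ^ 4 := pow_le_pow_right₀ hΛr (by norm_num)
        calc (K₂ : ℝ) ^ (2 * q * 2) * (4 * Λ ^ 2) ≤ K ^ (16 * q) * (16 * Λ ^ 4) := by
              gcongr; norm_num
          _ = _ := by ring
      · rw [abs_mul, abs_of_nonneg ht, mul_comm]
        gcongr
        exact le_max_left _ _) hy1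
  obtain ⟨U₄, hU₄, e₄⟩ := H₄ Λ hΛ (quarticTerm Λ) 128 (by norm_num)
    (by simpa [smul_smul] using generates_quarticTerm hΛ) q hq (t * (κ / 2) / R) y
    (by
      refine hscale _ (by positivity) ?_ _ ?_
      · rw [mul_pow, ← pow_mul, show (2 * (Λ : ℝ)) ^ 4 = 16 * Λ ^ 4 by ring]
        have h1 : (K₄ : ℝ) ^ (4 * q * 4) ≤ K ^ (16 * q) :=
          (pow_le_pow_left₀ (by positivity) hK₄K _).trans (pow_le_pow_right₀ hKr (by omega))
        calc (K₄ : ℝ) ^ (4 * q * 4) * (16 * Λ ^ 4) ≤ K ^ (16 * q) * (16 * Λ ^ 4) := by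
              gcongr
          _ = _ := by ring
      · rw [abs_mul, abs_of_nonneg ht, mul_comm, abs_div, abs_two]
        gcongr
        linarith [le_max_right |ω| |κ|, abs_nonneg κ]) hy1
  have hye : 0 ≤ y ^ ((q : ℝ) + 1 / 4) := by positivity
  obtain ⟨g, hg, hge⟩ := exists_circuit_of_segments hR0 hU₂ hU₄
    (e₂.trans (mul_le_mul_of_nonneg_right hK₂K hye))
    (e₄.trans (mul_le_mul_of_nonneg_right hK₄K hye))
  refine ⟨g, ?_, hge.trans (by rwa [← mul_assoc 2])⟩
  -- The cost of a segment is exponential in `q`; together with `R = r B ^ q` this gives `c = log (2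
  -- B K⁴)`.
  have h5 : (K₂ : ℝ) ^ (2 * q) + K₄ ^ (4 * q) ≤ (2 * K ^ 4) ^ q := by
    have h1 : (K₂ : ℝ) ^ (2 * q) ≤ K ^ (4 * q) :=
      (pow_le_pow_left₀ (by positivity) hK₂K _).trans (pow_le_pow_right₀ hKr (by omega))
    have h2 : (K₄ : ℝ) ^ (4 * q) ≤ K ^ (4 * q) := pow_le_pow_left₀ (by positivity) hK₄K _
    have h3 : (2 : ℝ) ≤ 2 ^ q := le_self_pow₀ (by norm_num) (by omega)
    rw [mul_pow, ← pow_mul]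
    have h4 : (0 : ℝ) ≤ K ^ (4 * q) := by positivity
    nlinarith
  calc (circuitCost g : ℝ) ≤ R * (K₂ ^ (2 * q) + K₄ ^ (4 * q)) := by exact_mod_cast hg
    _ ≤ R * (2 * K ^ 4) ^ q := by gcongr
    _ = r * Real.exp (Real.log (2 * B * K ^ 4) * q) := by
      rw [mul_comm (Real.log _), Real.exp_nat_mul, Real.exp_log (by positivity), ← hRr, mul_assoc,
        ← mul_pow]
      congr 2; ring
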